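/- For topological spaces $X,Y$, a continuous multivalued map $X\to Y$ is a subset $T\subseteq X\times Y$ such that the projection $T\to X$ is proper (universally closed), surjective and has finite fibers; write $M(X,Y)$ for the set of these. For a continuous map $f:X'\to X$ and $T\in M(X,Y)$, the composite $T\circ f=\{(x',y)\mid (f(x'),y)\in T\}$ lies in $M(X',Y)$; if $f$ is the inclusion of a subspace, $T\circ f$ is denoted $T|_{X'}$. Let $S^M_*(X)$ be the simplicial set with $S^M_n(X)=M(\Delta_n,X)$, where $\Delta_n$ is the standard topological $n$-simplex, with faces and degeneracies given by composition with the standard affine maps between simplices. A nonempty finite subset $A\subseteq X$ is regarded as a $0$-simplex of $S^M_*(X)$. 1. (Pasting) Let $X,Y$ be topological spaces, $X=X_1\cup\dots\cup X_k$ a finite cover by closed subspaces, and $T_i\in M(X_i,Y)$ with $T_i|_{X_i\cap X_j}=T_j|_{X_i\cap X_j}$ for all $i,j$. Then there is a unique $T\in M(X,Y)$ with $T|_{X_i}=T_i$ for all $i$. 2. For every topological space $X$, $S^M_*(X)$ is a Kan complex. Hence, for every nonempty finite $A\subseteq X$ and every $n>0$, the simplicial homotopy group $\pi^M_n(X,A):=\pi_n(S^M_*(X),A)$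 is defined. 3. If $X$ is path-connected and $A,B\subseteq X$ are nonempty finite subsets, then $\pi^M_n(X,A)\cong\pi^M_n(X,B)$ as groups for every $n>0$. 4. If $X$ is compact and Hausdorff, then $\pi^M_n(X,A)=0$ for every nonempty finite $A\subseteq X$ and every $n>0$. -/

import Mathlib

open CategoryTheory Simplicial

universe u v w

namespace SSet

variable {K : SSet.{u}} {x : K _⦋0⦌} {n : ℕ}

/-- The underlying set of the `n`-th simplicial homotopy group of `(K, x)`: `n`-simplices with
constant boundary `x`, where `f` and `g` are identified if they are the faces `n` and `n + 1` of an
`(n + 1)`-simplex whose other faces are constant. (For a Kan complex this relation is already an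
equivalence relation, see `PiGrp.rel_equivalence` below.) -/
def PiGrp (K : SSet.{u}) (n : ℕ) (x : K _⦋0⦌) : Type u :=
  Quot fun f g : K.PtSimplex n x => Nonempty (PtSimplex.RelStruct f g (Fin.last n))

namespace PiGrp

/-- `a` is the family of faces of an `(n + 1)`-simplex. -/
def Bdry (a : Fin (n + 2) → (Δ[n] ⟶ K)) : Prop :=
  ∃ s : Δ[n + 1] ⟶ K, ∀ j, stdSimplex.δ j ≫ s = a j

lemma bdry_of_matrix [KanComplex K] (b : Fin (n + 4) → Fin (n + 3) → (Δ[n + 1] ⟶ K))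
    (hb : ∀ (j k : Fin (n + 4)) (h : j < k),
      b j (k.pred (Fin.ne_zero_of_lt h)) = b k (j.castPred (Fin.ne_last_of_lt h)))
    (i : Fin (n + 4)) (h : ∀ j, j ≠ i → Bdry (b j)) : Bdry (b i) := by
  choose s hs using h
  have hc : horn.IsCompatible s := by
    intro j k hj hk hjk
    rw [hs, hs, hb j k hjk]
  obtain ⟨φ, hφ⟩ := hc.exists_lift_of_kanComplex
  refine ⟨stdSimplex.δ i ≫ φ, fun l => ?_⟩
  rcases lt_or_ge l.castSucc i with hl | hl
  · obtain ⟨i', rfl⟩ := i.eq_succ_of_ne_zero (Fin.ne_zero_of_lt hl)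
    have hl' : l ≤ i' := Fin.le_def.2 (Nat.lt_succ_iff.1 hl)
    rw [stdSimplex.δ_comp_δ_assoc hl', hφ _ hl.ne, hs]
    simpa using hb _ _ hl
  · have hl' : i < l.succ := Fin.lt_def.2 (Nat.lt_succ_iff.2 hl)
    obtain ⟨i', rfl⟩ := i.eq_castSucc_of_ne_last (Fin.ne_last_of_lt hl')
    have hl2 : i' ≤ l := hl
    rw [← stdSimplex.δ_comp_δ_assoc hl2, hφ _ hl'.ne', hs]
    simpa using (hb _ _ hl').symm

/-- The family of faces which are constant except for the last three, which are `a`, `b`, `c`. -/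
def tri (x : K _⦋0⦌) (a b c : Δ[n + 1] ⟶ K) (l : Fin (n + 3)) : Δ[n + 1] ⟶ K :=
  if l.val = n then a else if l.val = n + 1 then b else if l.val = n + 2 then c else const x

/-- There is an `(n + 2)`-simplex whose last three faces are `a`, `b`, `c` and whose other faces
are constant. -/
def Tri (x : K _⦋0⦌) (a b c : Δ[n + 1] ⟶ K) : Prop := Bdry (tri x a b c)

/-- The faces of the faces of an `(n + 3)`-simplex. -/
def quad (x : K _⦋0⦌) (p q r s t w : Δ[n + 1] ⟶ K) (j : Fin (n + 4)) :
    Fin (n + 3) → (Δ[n + 1] ⟶ K) :=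
  if j.val = n then tri x p q r else if j.val = n + 1 then tri x p s t
  else if j.val = n + 2 then tri x q s w else if j.val = n + 3 then tri x r t w
  else fun _ => const x

lemma quad_compat (p q r s t w : Δ[n + 1] ⟶ K) (j k : Fin (n + 4)) (h : j < k) :
    quad x p q r s t w j (k.pred (Fin.ne_zero_of_lt h)) =
      quad x p q r s t w k (j.castPred (Fin.ne_last_of_lt h)) := by
  have h1 : j.val < k.val := h
  have h2 : (k.pred (Fin.ne_zero_of_lt h)).val = k.val - 1 := rfl
  have h3 : (j.castPred (Fin.ne_last_of_lt h)).val = j.val := rfl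
  have h4 := k.isLt
  simp only [quad]
  split_ifs <;> simp only [tri, h2, h3] <;> split_ifs <;> first | rfl | omega

lemma bdry_quad [KanComplex K] {p q r s t w : Δ[n + 1] ⟶ K} (i : Fin (n + 4))
    (hA : i.val ≠ n → Tri x p q r) (hB : i.val ≠ n + 1 → Tri x p s t)
    (hC : i.val ≠ n + 2 → Tri x q s w) (hD : i.val ≠ n + 3 → Tri x r t w) :
    Bdry (quad x p q r s t w i) := by
  refine bdry_of_matrix _ (quad_compat p q r s t w) i fun j hj => ?_
  have hj' : i.val ≠ j.val := fun e => hj (Fin.ext e.symm)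
  unfold quad
  split_ifs with h1 h2 h3 h4
  · exact hA (fun e => hj' (e.trans h1.symm))
  · exact hB (fun e => hj' (e.trans h2.symm))
  · exact hC (fun e => hj' (e.trans h3.symm))
  · exact hD (fun e => hj' (e.trans h4.symm))
  · exact ⟨const x, fun _ => rfl⟩

lemma tri_B [KanComplex K] {p q r s t w : Δ[n + 1] ⟶ K} (hA : Tri x p q r) (hC : Tri x q s w)
    (hD : Tri x r t w) : Tri x p s t := by
  have := bdry_quad (x := x) (p := p) (q := q) (r := r) (s := s) (t := t) (w := w)
    ⟨n + 1, by omega⟩ (fun _ => hA) (by simp) (fun _ => hC) (fun _ => hD)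
  simpa [quad, Tri] using this

lemma tri_C [KanComplex K] {p q r s t w : Δ[n + 1] ⟶ K} (hA : Tri x p q r) (hB : Tri x p s t)
    (hD : Tri x r t w) : Tri x q s w := by
  have := bdry_quad (x := x) (p := p) (q := q) (r := r) (s := s) (t := t) (w := w)
    ⟨n + 2, by omega⟩ (fun _ => hA) (fun _ => hB) (by simp) (fun _ => hD)
  simpa [quad, Tri] using this

lemma tri_D [KanComplex K] {p q r s t w : Δ[n + 1] ⟶ K} (hA : Tri x p q r) (hB : Tri x p s t)
    (hC : Tri x q s w) : Tri x r t w := by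
  have := bdry_quad (x := x) (p := p) (q := q) (r := r) (s := s) (t := t) (w := w)
    ⟨n + 3, by omega⟩ (fun _ => hA) (fun _ => hB) (fun _ => hC) (by simp)
  simpa [quad, Tri] using this

/-- The pointed simplex given by a simplex all of whose faces are constant. -/
def ofFaces (f : Δ[n + 1] ⟶ K) (hf : ∀ j, stdSimplex.δ j ≫ f = const x) :
    K.PtSimplex (n + 1) x where
  map := f
  comm := by
    refine boundary.hom_ext fun j => ?_
    rw [boundary.ι_ι_assoc, hf]
    rfl

lemma δ_tri (a b c : K.PtSimplex (n + 1) x) (l : Fin (n + 3)) (j : Fin (n + 2)) :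
    stdSimplex.δ j ≫ tri x a.map b.map c.map l = const x := by
  unfold tri
  split_ifs <;> simp

lemma exists_fill [KanComplex K] (a b c : K.PtSimplex (n + 1) x) (i : Fin (n + 3)) :
    ∃ s : Δ[n + 2] ⟶ K, (∀ j, j ≠ i → stdSimplex.δ j ≫ s = tri x a.map b.map c.map j) ∧
      ∀ j, stdSimplex.δ j ≫ stdSimplex.δ i ≫ s = const x := by
  have hc : horn.IsCompatible (i := i) (fun j (_ : j ≠ i) => tri x a.map b.map c.map j) := by
    intro j k hj hk hjk
    rw [δ_tri, δ_tri]
  obtain ⟨φ, hφ⟩ := hc.exists_lift_of_kanComplex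
  refine ⟨φ, hφ, fun l => ?_⟩
  rcases lt_or_ge l.castSucc i with hl | hl
  · obtain ⟨i', rfl⟩ := i.eq_succ_of_ne_zero (Fin.ne_zero_of_lt hl)
    have hl' : l ≤ i' := Fin.le_def.2 (Nat.lt_succ_iff.1 hl)
    rw [stdSimplex.δ_comp_δ_assoc hl', hφ _ hl.ne, δ_tri]
  · have hl' : i < l.succ := Fin.lt_def.2 (Nat.lt_succ_iff.2 hl)
    obtain ⟨i', rfl⟩ := i.eq_castSucc_of_ne_last (Fin.ne_last_of_lt hl')
    have hl2 : i' ≤ l := hl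
    rw [← stdSimplex.δ_comp_δ_assoc hl2, hφ _ hl'.ne', δ_tri]

lemma exists_tri_mid [KanComplex K] (a c : K.PtSimplex (n + 1) x) :
    ∃ b : K.PtSimplex (n + 1) x, Tri x a.map b.map c.map := by
  obtain ⟨s, hs, hs'⟩ := exists_fill a a c ⟨n + 1, by omega⟩
  refine ⟨ofFaces _ hs', s, fun j => ?_⟩
  by_cases hj : j = ⟨n + 1, by omega⟩
  · subst hj
    simp [tri, ofFaces]
  · rw [hs j hj]
    have : j.val ≠ n + 1 := fun e => hj (Fin.ext e)
    simp [tri, this]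

lemma exists_tri_left [KanComplex K] (b c : K.PtSimplex (n + 1) x) :
    ∃ a : K.PtSimplex (n + 1) x, Tri x a.map b.map c.map := by
  obtain ⟨s, hs, hs'⟩ := exists_fill b b c ⟨n, by omega⟩
  refine ⟨ofFaces _ hs', s, fun j => ?_⟩
  by_cases hj : j = ⟨n, by omega⟩
  · subst hj
    simp [tri, ofFaces]
  · rw [hs j hj]
    have : j.val ≠ n := fun e => hj (Fin.ext e)
    simp [tri, this]

lemma tri_iff (a b c : K.PtSimplex (n + 1) x) :
    Tri x a.map b.map c.map ↔ Nonempty (PtSimplex.MulStruct c a b (Fin.last n)) := by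
  constructor
  · rintro ⟨s, hs⟩
    refine ⟨⟨s, ?_, ?_, ?_, fun j hj => ?_, fun j hj => ?_⟩⟩
    · rw [hs]; simp [tri]
    · rw [hs]; simp [tri]
    · rw [hs]; simp [tri, add_assoc]
    · rw [hs]
      have : j.val < n := hj
      unfold tri
      split_ifs <;> first | rfl | omega
    · have : n + 2 < j.val := hj
      omega
  · rintro ⟨h⟩
    refine ⟨h.map, fun j => ?_⟩
    unfold tri
    split_ifs with h1 h2 h3
    · rw [← h.δ_castSucc_castSucc_map]; congr 2; exact Fin.ext h1
    · rw [← h.δ_succ_castSucc_map]; congr 2; exact Fin.ext h2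
    · rw [← h.δ_succ_succ_map]; congr 2; exact Fin.ext h3
    · exact h.δ_map_of_lt _ (by rw [Fin.lt_def]; simp; omega)

lemma tri_one_left (a : K.PtSimplex (n + 1) x) : Tri x (const x) a.map a.map :=
  (tri_iff .const a a).2 ⟨.mulOne a _⟩

lemma tri_one_right (a : K.PtSimplex (n + 1) x) : Tri x a.map a.map (const x) :=
  (tri_iff a a .const).2 ⟨.oneMul a _⟩

lemma rel_iff (f g : K.PtSimplex (n + 1) x) :
    Nonempty (PtSimplex.RelStruct f g (Fin.last (n + 1))) ↔ Tri x (const x) f.map g.map := by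
  rw [show Tri x (const x) f.map g.map ↔ _ from tri_iff .const f g]
  exact (PtSimplex.relStructSuccEquivMulStruct (i := Fin.last n)).nonempty_congr

lemma rel_equivalence [KanComplex K] (n : ℕ) (x : K _⦋0⦌) :
    Equivalence fun f g : K.PtSimplex (n + 1) x =>
      Nonempty (PtSimplex.RelStruct f g (Fin.last (n + 1))) := by
  have h : ∀ f g : K.PtSimplex (n + 1) x, Tri x (const x) f.map g.map →
      Tri x (const x) g.map f.map := fun f g h =>
    tri_D (tri_one_left .const) h (tri_one_left f)
  simp only [rel_iff]
  exact ⟨tri_one_left, h _ _, fun h1 h2 => tri_D (tri_one_left .const) (h _ _ h1) h2⟩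

/-- The class of a pointed simplex. -/
def mk (f : K.PtSimplex n x) : PiGrp K n x := Quot.mk _ f

lemma mk_eq_iff [KanComplex K] (f g : K.PtSimplex (n + 1) x) :
    mk f = mk g ↔ Tri x (const x) f.map g.map := by
  rw [← rel_iff]
  exact (rel_equivalence n x).quot_mk_eq_iff f g

lemma tri_unique [KanComplex K] {a b b' c : K.PtSimplex (n + 1) x}
    (h : Tri x a.map b.map c.map) (h' : Tri x a.map b'.map c.map) :
    Tri x (const x) b.map b'.map :=
  tri_B (tri_one_left b) (tri_one_right b) (tri_C h h' (tri_one_right c))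

lemma tri_congr [KanComplex K] {a a' b c c' : K.PtSimplex (n + 1) x}
    (h : Tri x a.map b.map c.map) (ha : Tri x (const x) a.map a'.map)
    (hc : Tri x (const x) c.map c'.map) : Tri x a'.map b.map c'.map := by
  exact tri_D ha (tri_one_left b) (tri_C (tri_one_right a) h hc)

/-- The product of the classes of `f` and `g` is the class of the face `n + 1` of an
`(n + 2)`-simplex whose face `n` is `f`, whose face `n + 2` is `g` and whose other faces are
constant. -/
noncomputable instance [KanComplex K] : Mul (PiGrp K (n + 1) x) where
  mul := Quot.lift₂ (fun f g => mk (exists_tri_mid f g).choose)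
    (fun f g g' h => (mk_eq_iff _ _).2 (tri_unique
      (tri_congr (exists_tri_mid f g).choose_spec (tri_one_left f) ((rel_iff g g').1 h))
      (exists_tri_mid f g').choose_spec))
    (fun f f' g h => (mk_eq_iff _ _).2 (tri_unique
      (tri_congr (exists_tri_mid f g).choose_spec ((rel_iff f f').1 h) (tri_one_left g))
      (exists_tri_mid f' g).choose_spec))

lemma mk_mul_mk [KanComplex K] {f g h : K.PtSimplex (n + 1) x}
    (H : Tri x f.map h.map g.map) :
    mk f * mk g = mk h :=
  (mk_eq_iff _ _).2 (tri_unique (exists_tri_mid f g).choose_spec H)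

lemma mk_mul_mk_iff [KanComplex K] (f g h : K.PtSimplex (n + 1) x) :
    mk f * mk g = mk h ↔
      Nonempty (PtSimplex.MulStruct g f h (Fin.last n)) := by
  rw [← tri_iff]
  refine ⟨fun e => ?_, mk_mul_mk⟩
  have H := (exists_tri_mid f g).choose_spec
  exact tri_D (tri_one_left f) ((mk_eq_iff (exists_tri_mid f g).choose h).1 e) H

instance : One (PiGrp K n x) := ⟨mk .const⟩

lemma exists_left_inv [KanComplex K] (a : PiGrp K (n + 1) x) : ∃ b, b * a = 1 := by
  obtain ⟨f⟩ := a
  obtain ⟨g, hg⟩ := exists_tri_left .const f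
  exact ⟨mk g, mk_mul_mk hg⟩

noncomputable instance [KanComplex K] : Inv (PiGrp K (n + 1) x) :=
  ⟨fun a => (exists_left_inv a).choose⟩

/-- The group structure on the homotopy groups of positive degree of a Kan complex. -/
noncomputable instance [KanComplex K] : Group (PiGrp K (n + 1) x) :=
  Group.ofLeftAxioms
    (by
      rintro ⟨f⟩ ⟨g⟩ ⟨h⟩
      obtain ⟨a, ha⟩ := exists_tri_mid f g
      obtain ⟨b, hb⟩ := exists_tri_mid g h
      obtain ⟨c, hc⟩ := exists_tri_mid f b
      change mk f * mk g * mk h = mk f * (mk g * mk h)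
      rw [mk_mul_mk ha, mk_mul_mk hb, mk_mul_mk hc, mk_mul_mk (tri_C ha hc hb)])
    (by
      rintro ⟨f⟩
      exact mk_mul_mk (tri_one_left f))
    (fun a => (exists_left_inv a).choose_spec)

end PiGrp

end SSet

/-- A continuous multivalued map `X → Y`: a subset of `X × Y` whose projection to `X` is proper
(universally closed), surjective and has finite fibers. -/
@[ext]
structure MultiMap (X : Type u) (Y : Type v) [TopologicalSpace X] [TopologicalSpace Y] where
  graph : Set (X × Y)
  proper : IsProperMap (fun p : graph => p.1.1)
  surjective : Function.Surjective (fun p : graph => p.1.1)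
  finite_fibers : ∀ x : X, ((fun p : graph => p.1.1) ⁻¹' {x}).Finite

namespace MultiMap

variable {X : Type u} {Y : Type v} {Z : Type w}
  [TopologicalSpace X] [TopologicalSpace Y] [TopologicalSpace Z]

/-- The composition `S ∘ gr(f)` of a multivalued map `S` with (the graph of) a continuous map `f`. -/
def precomp (f : C(X, Y)) (S : MultiMap Y Z) : MultiMap X Z where
  graph := {p | (f p.1, p.2) ∈ S.graph}
  proper := by
    rw [isProperMap_iff_ultrafilter]
    refine ⟨by fun_prop, fun U x hU => ?_⟩
    let g : ({p | (f p.1, p.2) ∈ S.graph} : Set (X × Z)) → S.graph := fun p => ⟨(f p.1.1, p.1.2), p.2⟩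
    have hV : Filter.Tendsto (fun p : S.graph => p.1.1) (U.map g) (nhds (f x)) := by
      rw [Ultrafilter.coe_map, Filter.tendsto_map'_iff]
      exact (f.continuous.tendsto x).comp hU
    obtain ⟨⟨⟨y, z⟩, hyz⟩, hy, hle⟩ := S.proper.ultrafilter_le_nhds_of_tendsto hV
    obtain rfl : y = f x := hy
    refine ⟨⟨(x, z), hyz⟩, rfl, ?_⟩
    rw [nhds_subtype_eq_comap, ← Filter.map_le_iff_le_comap, nhds_prod_eq]
    refine Filter.Tendsto.prodMk hU ?_
    have h2 : Filter.Tendsto g U (nhds ⟨(f x, z), hyz⟩) := by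
      simpa [Filter.Tendsto] using hle
    exact (continuous_snd.comp continuous_subtype_val).continuousAt.tendsto.comp h2
  surjective x := by
    obtain ⟨⟨⟨y, z⟩, hyz⟩, hy⟩ := S.surjective (f x)
    obtain rfl : y = f x := hy
    exact ⟨⟨(x, z), hyz⟩, rfl⟩
  finite_fibers x := by
    refine Set.Finite.of_finite_image (f := fun p => (⟨(f p.1.1, p.1.2), p.2⟩ : S.graph))
      ((S.finite_fibers (f x)).subset ?_) ?_
    · rintro _ ⟨p, hp, rfl⟩
      have hp' : p.1.1 = x := hp
      simp [hp']
    · rintro ⟨⟨a, b⟩, h⟩ hp ⟨⟨a', b'⟩, h'⟩ hp' e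
      obtain rfl : a = x := hp
      obtain rfl : a' = a := hp'
      simp at e
      simp [e]

/-- The restriction of a multivalued map to a subspace of its source. -/
def restrict (S : MultiMap X Y) (C : Set X) : MultiMap C Y :=
  S.precomp ⟨Subtype.val, continuous_subtype_val⟩

/-- The constant multivalued map with value a nonempty finite set `A`. -/
def const (X : Type u) [TopologicalSpace X] (A : Set Y) (hA : A.Finite) (hne : A.Nonempty) :
    MultiMap X Y where
  graph := {p | p.2 ∈ A}
  proper := by
    have : CompactSpace A := isCompact_iff_compactSpace.1 hA.isCompact
    let e : ({p | p.2 ∈ A} : Set (X × Y)) ≃ₜ X × A :=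
      { toFun p := (p.1.1, ⟨p.1.2, p.2⟩)
        invFun p := ⟨(p.1, p.2.1), p.2.2⟩
        left_inv _ := rfl
        right_inv _ := rfl
        continuous_toFun := by fun_prop
        continuous_invFun := by fun_prop }
    exact (isProperMap_fst_of_compactSpace (X := X) (Y := A)).comp e.isProperMap
  surjective x := by
    obtain ⟨a, ha⟩ := hne
    exact ⟨⟨(x, a), ha⟩, rfl⟩
  finite_fibers x := by
    refine Set.Finite.of_finite_image (f := fun p => p.1.2) (hA.subset ?_) ?_
    · rintro _ ⟨p, _, rfl⟩
      exact p.2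
    · rintro ⟨⟨a, b⟩, h⟩ hp ⟨⟨a', b'⟩, h'⟩ hp' e
      obtain rfl : a = x := hp
      obtain rfl : a' = a := hp'
      obtain rfl : b = b' := e
      rfl

/-- The simplicial set `S_*^M(X)`: its `n`-simplices are the continuous multivalued maps from the
standard topological `n`-simplex to `X`, and its faces and degeneracies are given by composition
with the affine maps between the standard simplices. -/
noncomputable def sing (X : Type u) [TopologicalSpace X] : SSet.{u} where
  obj n := MultiMap (SimplexCategory.toTop₀.obj n.unop) X
  map f := ↾(MultiMap.precomp (SimplexCategory.toTop₀.map f.unop).hom)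
  map_id n := by
    refine ConcreteCategory.hom_ext _ _ fun S => ?_
    exact (congrArg (fun h : SimplexCategory.toTop₀.obj n.unop ⟶ SimplexCategory.toTop₀.obj n.unop =>
      precomp h.hom S) (SimplexCategory.toTop₀.map_id n.unop))
  map_comp f g := by
    refine ConcreteCategory.hom_ext _ _ fun S => ?_
    exact (congrArg (fun h => precomp (TopCat.Hom.hom h) S)
      (SimplexCategory.toTop₀.map_comp g.unop f.unop))

/-- A nonempty finite subset `A` of `X`, seen as a `0`-simplex of `S_*^M(X)`. -/
noncomputable def vertex (A : Set X) (hA : A.Finite) (hne : A.Nonempty) : (sing X) _⦋0⦌ :=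
  MultiMap.const (SimplexCategory.toTop₀.obj ⦋0⦌) A hA hne

/-- The multivalued homotopy group `π_n^M(X, A)`. -/
abbrev PiM (n : ℕ) (A : Set X) (hA : A.Finite) (hne : A.Nonempty) : Type u :=
  (sing X).PiGrp n (vertex A hA hne)

end MultiMap

/-! The pointwise union of two multivalued maps is again a multivalued map, and it commutes with
precomposition. So union is a simplicial map `μ` on `sing X` that is idempotent, commutative and
associative.

Such a `μ` kills all homotopy groups of a Kan complex (`subsingleton_of_semilattice`): from `f · 1 =
f = 1 · f`, applying `μ` to the two witnessing simplices shows that `[f]` is the square of the class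
of `μ (f, x)`. The operation `f ↦ μ (f, x)` is idempotent, so that class equals its own square and
is trivial. Both statements about homotopy groups follow.

The Kan property comes from pasting: compatible faces glue to a multivalued map on the topological
horn, which extends to the simplex by composition with a retraction. Pasting is proved for closed
embeddings (`existsUnique_precomp_eq`), so that it applies both to closed subspaces and to the faces
of a horn. -/

section Semilattice

open MonoidalCategory CartesianMonoidalCategory

/-! ### Homotopy groups of a simplicial semilattice. -/

namespace SSet.PiGrp

variable {K : SSet.{u}} {x : K _⦋0⦌} {n : ℕ}

/-- Pairing the two filling simplices and applying `μ` fills the new triple; `hx` keeps the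
remaining faces constant. This is what makes `μ` compatible with the group law. -/
lemma Tri.lift_comp (μ : K ⊗ K ⟶ K) (hx : ∀ {L : SSet.{u}}, lift (const x) (const x) ≫ μ =
    (const x : L ⟶ K)) {a b c a' b' c' : Δ[n + 1] ⟶ K} (h : Tri x a b c) (h' : Tri x a' b' c') :
    Tri x (lift a a' ≫ μ) (lift b b' ≫ μ) (lift c c' ≫ μ) := by
  obtain ⟨s, hs⟩ := h
  obtain ⟨s', hs'⟩ := h'
  refine ⟨lift s s' ≫ μ, fun j => ?_⟩
  rw [comp_lift_assoc, hs, hs']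
  unfold tri
  split_ifs
  · rfl
  · rfl
  · rfl
  · exact hx

/-- The homotopy groups of a Kan complex which carries a simplicial semilattice structure `μ` are
trivial. Indeed, put `φ f = μ (f, x)`; then `f = μ (f, f)` is homotopic to `φ f * φ f`, and
`φ (φ f) = φ f`, so that the class of `φ f` is idempotent. -/
theorem subsingleton_of_semilattice [KanComplex K] (μ : K ⊗ K ⟶ K)
    (idem : ∀ {L : SSet.{u}} (f : L ⟶ K), lift f f ≫ μ = f)
    (comm : ∀ {L : SSet.{u}} (f g : L ⟶ K), lift f g ≫ μ = lift g f ≫ μ)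
    (assoc : ∀ {L : SSet.{u}} (f g h : L ⟶ K),
      lift (lift f g ≫ μ) h ≫ μ = lift f (lift g h ≫ μ) ≫ μ)
    (n : ℕ) (x : K _⦋0⦌) : Subsingleton (PiGrp K (n + 1) x) := by
  let φ (f : K.PtSimplex (n + 1) x) : K.PtSimplex (n + 1) x :=
    ofFaces (lift f.map (const x) ≫ μ) fun j => by
      rw [comp_lift_assoc, PtSimplex.δ_map, comp_const, idem]
  have mul_self (f : K.PtSimplex (n + 1) x) : mk (φ f) * mk (φ f) = mk f := by
    refine mk_mul_mk ?_
    -- The witnesses of `f · 1 = f` and `1 · f = f` combine to one of `μ (f, x) · μ (x, f) = μ (f,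
    -- f)`.
    have h := Tri.lift_comp μ (idem _) (tri_one_right f) (tri_one_left f)
    rwa [idem, comm (const x)] at h
  have φ_φ (f : K.PtSimplex (n + 1) x) : φ (φ f) = φ f :=
    RelativeMorphism.ext ((assoc _ _ _).trans (by rw [idem]; rfl))
  have eq_one (a : PiGrp K (n + 1) x) : a = 1 := by
    obtain ⟨f⟩ := a
    -- With `φ (φ f) = φ f` this says that the class of `φ f` is its own square, hence `1`.
    have h := mul_self (φ f)
    rw [φ_φ, mul_eq_left] at h
    change mk f = 1
    rw [← mul_self f, h, one_mul]
  exact ⟨fun a b => (eq_one a).trans (eq_one b).symm⟩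

end SSet.PiGrp

end Semilattice

/-! ### Pasting and union of multivalued maps. -/

lemma isProperMap_sigma {ι : Type*} [Finite ι] {W : ι → Type*} [∀ i, TopologicalSpace (W i)]
    {X : Type*} [TopologicalSpace X] {f : (Σ i, W i) → X}
    (hf : ∀ i, IsProperMap fun w => f ⟨i, w⟩) : IsProperMap f := by
  -- Images and fibers are finite unions of those of the summands, which preserves closedness and
  -- compactness.
  rw [isProperMap_iff_isClosedMap_and_compact_fibers]
  refine ⟨continuous_sigma fun i => (hf i).continuous, fun Z hZ => ?_, fun x => ?_⟩
  · have : f '' Z = ⋃ i, (fun w => f ⟨i, w⟩) '' (Sigma.mk i ⁻¹' Z) := by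
      ext x
      simp [Sigma.exists]
    rw [this]
    exact isClosed_iUnion_of_finite fun i =>
      (hf i).isClosedMap _ (hZ.preimage continuous_sigmaMk)
  · have : f ⁻¹' {x} = ⋃ i, Sigma.mk i '' ((fun w => f ⟨i, w⟩) ⁻¹' {x}) := by
      ext ⟨i, w⟩
      simp only [Set.mem_preimage, Set.mem_iUnion, Set.mem_image]
      exact ⟨fun h => ⟨i, w, h, rfl⟩, by rintro ⟨j, v, h, e⟩; exact e ▸ h⟩
    rw [this]
    exact isCompact_iUnion fun i =>
      ((hf i).isCompact_preimage isCompact_singleton).image continuous_sigmaMk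

namespace MultiMap

variable {X : Type u} {Y : Type v} {Z : Type w}
  [TopologicalSpace X] [TopologicalSpace Y] [TopologicalSpace Z]

lemma graph_injective : Function.Injective (graph : MultiMap X Y → Set (X × Y)) :=
  fun _ _ => MultiMap.ext

@[simp]
lemma mem_graph_precomp (f : C(X, Y)) (S : MultiMap Y Z) (p : X × Z) :
    p ∈ (S.precomp f).graph ↔ (f p.1, p.2) ∈ S.graph := Iff.rfl

lemma exists_mem_graph (S : MultiMap X Y) (x : X) : ∃ y, (x, y) ∈ S.graph := by
  obtain ⟨⟨⟨x', y⟩, h⟩, rfl⟩ := S.surjective x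
  exact ⟨y, h⟩

/-- The union of the images of finitely many maps `(f i, g i) : W i → X × Y`, where the `f i` are
proper with finite fibers and jointly surjective. -/
def ofFamily {ι : Type*} [Finite ι] {W : ι → Type*} [∀ i, TopologicalSpace (W i)]
    (f : ∀ i, W i → X) (g : ∀ i, W i → Y) (hf : ∀ i, IsProperMap (f i))
    (hg : ∀ i, Continuous (g i)) (hsurj : ∀ x, ∃ i w, f i w = x)
    (hfin : ∀ i x, (f i ⁻¹' {x}).Finite) : MultiMap X Y where
  graph := {p | ∃ i w, (f i w, g i w) = p}
  proper := by
    let F : (Σ i, W i) → ({p | ∃ i w, (f i w, g i w) = p} : Set (X × Y)) :=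
      fun q => ⟨(f q.1 q.2, g q.1 q.2), q.1, q.2, rfl⟩
    -- The disjoint union of the `W i` is proper over `X` and surjects onto the graph, so properness
    -- descends to the graph.
    refine isProperMap_of_comp_of_surj (f := F) ?_ (by fun_prop) (isProperMap_sigma hf) ?_
    · exact continuous_sigma fun i =>
        Continuous.subtype_mk ((hf i).continuous.prodMk (hg i)) _
    · rintro ⟨_, i, w, rfl⟩
      exact ⟨⟨i, w⟩, rfl⟩
  surjective x := by
    obtain ⟨i, w, rfl⟩ := hsurj x
    exact ⟨⟨(f i w, g i w), i, w, rfl⟩, rfl⟩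
  finite_fibers x := by
    refine Set.Finite.of_finite_image (f := Subtype.val)
      ((Set.finite_iUnion fun i => (hfin i x).image fun w => (f i w, g i w)).subset ?_)
      Subtype.val_injective.injOn
    rintro _ ⟨⟨_, i, w, rfl⟩, hx, rfl⟩
    exact Set.mem_iUnion.2 ⟨i, w, hx, rfl⟩

/-- Pasting of multivalued maps along a finite family of closed embeddings that covers `X`. -/
theorem existsUnique_precomp_eq {ι : Type*} [Finite ι] {C : ι → Type*}
    [∀ i, TopologicalSpace (C i)] (e : ∀ i, C(C i, X))
    (he : ∀ i, Topology.IsClosedEmbedding (e i)) (hsurj : ∀ x, ∃ i c, e i c = x)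
    (T : ∀ i, MultiMap (C i) Y)
    (hT : ∀ i j a b y, e i a = e j b → (a, y) ∈ (T i).graph → (b, y) ∈ (T j).graph) :
    ∃! S : MultiMap X Y, ∀ i, S.precomp (e i) = T i := by
  refine ⟨ofFamily (W := fun i => (T i).graph) (fun i p => e i p.1.1) (fun i p => p.1.2)
    (fun i => (he i).isProperMap.comp (T i).proper) (fun i => by fun_prop) (fun x => ?_)
    (fun i x => ?_), fun i => ?_, fun S hS => ?_⟩
  · obtain ⟨i, c, rfl⟩ := hsurj x
    obtain ⟨y, hy⟩ := (T i).exists_mem_graph c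
    exact ⟨i, ⟨(c, y), hy⟩, rfl⟩
  · rcases (e i ⁻¹' {x}).eq_empty_or_nonempty with h | ⟨c, rfl⟩
    · convert! Set.finite_empty
      ext p
      exact ⟨fun hp => h.subset hp, False.elim⟩
    · exact ((T i).finite_fibers c).subset fun p hp => (he i).injective hp
  · refine graph_injective (Set.ext fun ⟨c, y⟩ => ⟨?_, fun h => ⟨i, ⟨(c, y), h⟩, rfl⟩⟩)
    -- A point of the pasted graph over `C i` may come from another piece `j`; compatibility moves
    -- it back into `T i`.
    rintro ⟨j, ⟨⟨a, y'⟩, h⟩, e'⟩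
    obtain ⟨h1, rfl⟩ := Prod.mk.inj e'
    exact hT _ _ _ _ _ h1 h
  · refine graph_injective (Set.ext fun ⟨x, y⟩ => ⟨fun h => ?_, ?_⟩)
    · obtain ⟨i, c, rfl⟩ := hsurj x
      refine ⟨i, ⟨(c, y), ?_⟩, rfl⟩
      rwa [← hS i]
    · rintro ⟨i, ⟨⟨c, y'⟩, h⟩, e'⟩
      obtain ⟨rfl, rfl⟩ := Prod.mk.inj e'
      rwa [← hS i] at h

/-- Points of `C i` and `C j` with the same image in `X` are one point of the intersection, where
the restrictions agree. -/
theorem existsUnique_restrict_eq {ι : Type*} [Finite ι] (C : ι → Set X)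
    (hC : ∀ i, IsClosed (C i)) (hcov : ⋃ i, C i = Set.univ) (T : ∀ i, MultiMap (C i) Y)
    (hT : ∀ i j,
      (T i).precomp (ContinuousMap.inclusion (Set.inter_subset_left : C i ∩ C j ⊆ C i)) =
      (T j).precomp (ContinuousMap.inclusion (Set.inter_subset_right : C i ∩ C j ⊆ C j))) :
    ∃! S : MultiMap X Y, ∀ i, S.restrict (C i) = T i := by
  refine existsUnique_precomp_eq (C := fun i => C i) (fun i => ⟨Subtype.val, continuous_subtype_val⟩)
    (fun i => (hC i).isClosedEmbedding_subtypeVal) (fun x => ?_) T ?_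
  · obtain ⟨i, hi⟩ := Set.mem_iUnion.1 (hcov.symm.subset (Set.mem_univ x))
    exact ⟨i, ⟨x, hi⟩, rfl⟩
  · rintro i j ⟨a, ha⟩ ⟨b, hb⟩ y (rfl : a = b) h
    have h' : ((⟨a, ha, hb⟩ : ↑(C i ∩ C j)), y) ∈ ((T i).precomp
      (ContinuousMap.inclusion (Set.inter_subset_left : C i ∩ C j ⊆ C i))).graph := h
    rw [hT] at h'
    exact h'

/-- The union of two multivalued maps. -/
def union (S T : MultiMap X Y) : MultiMap X Y :=
  -- The two graphs overlap freely here: `ofFamily` asks for no compatibility between its members.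
  (ofFamily (W := fun b : Bool => (cond b S T).graph) (fun _ p => p.1.1) (fun _ p => p.1.2)
    (fun b => (cond b S T).proper) (fun _ => by fun_prop)
    (fun x => ⟨true, S.surjective x⟩) (fun b => (cond b S T).finite_fibers))

@[simp]
lemma mem_graph_union (S T : MultiMap X Y) (p : X × Y) :
    p ∈ (S.union T).graph ↔ p ∈ S.graph ∨ p ∈ T.graph := by
  refine ⟨?_, ?_⟩
  · rintro ⟨_ | _, ⟨p, h⟩, rfl⟩
    exacts [.inr h, .inl h]
  · rintro (h | h)
    exacts [⟨true, ⟨p, h⟩, rfl⟩, ⟨false, ⟨p, h⟩, rfl⟩]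

lemma union_self (S : MultiMap X Y) : S.union S = S :=
  graph_injective (Set.ext fun _ => by rw [mem_graph_union, or_self])

lemma union_comm (S T : MultiMap X Y) : S.union T = T.union S :=
  graph_injective (Set.ext fun _ => by rw [mem_graph_union, mem_graph_union, or_comm])

lemma union_assoc (S T R : MultiMap X Y) : (S.union T).union R = S.union (T.union R) :=
  graph_injective (Set.ext fun _ => by simp only [mem_graph_union, or_assoc])

/-- Precomposition takes preimages of graphs, and preimages commute with unions. This is the
naturality of `singUnion`. -/
lemma precomp_union (f : C(X, Y)) (S T : MultiMap Y Z) :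
    (S.union T).precomp f = (S.precomp f).union (T.precomp f) :=
  graph_injective (Set.ext fun _ => by simp only [mem_graph_union, mem_graph_precomp])

open MonoidalCategory in
/-- The union of multivalued maps as a simplicial map. -/
noncomputable def singUnion (X : Type u) [TopologicalSpace X] : sing X ⊗ sing X ⟶ sing X where
  app n := ↾fun p => union p.1 p.2
  naturality m n f := by
    ext p
    exact (precomp_union _ _ _).symm

/-- All homotopy groups of `sing X` are trivial, since unions make it a simplicial semilattice. -/
theorem subsingleton_piM [SSet.KanComplex (sing X)] (n : ℕ) (A : Set X) (hA : A.Finite)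
    (hne : A.Nonempty) : Subsingleton (PiM (n + 1) A hA hne) := by
  refine SSet.PiGrp.subsingleton_of_semilattice (singUnion X) (fun f => ?_) (fun f g => ?_)
    (fun f g h => ?_) n _
  all_goals ext m s
  · exact union_self _
  · exact union_comm _ _
  · exact union_assoc _ _ _

end MultiMap

/-! ### Faces of the topological simplex and the retraction onto a horn. -/

namespace stdSimplex

variable {n : ℕ}

@[simp]
lemma map_succAbove_self (j : Fin (n + 2)) (a : stdSimplex ℝ (Fin (n + 1))) :
    map j.succAbove a j = 0 := by
  rw [map_coe, FunOnFinite.linearMap_apply_apply, Finset.filter_false_of_mem, Finset.sum_empty]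
  exact fun l _ => Fin.succAbove_ne j l

@[simp]
lemma map_succAbove_succAbove (j : Fin (n + 2)) (a : stdSimplex ℝ (Fin (n + 1)))
    (l : Fin (n + 1)) : map j.succAbove a (j.succAbove l) = a l := by
  rw [map_coe, FunOnFinite.linearMap_apply_apply]
  simp [Finset.filter_eq']

lemma map_succAbove_injective (j : Fin (n + 2)) :
    Function.Injective (map (S := ℝ) j.succAbove) := by
  intro a b h
  ext l
  rw [← map_succAbove_succAbove j a, h, map_succAbove_succAbove]

lemma exists_map_succAbove_eq {j : Fin (n + 2)} {x : stdSimplex ℝ (Fin (n + 2))} (hx : x j = 0) :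
    ∃ a, map j.succAbove a = x := by
  refine ⟨⟨fun l => x (j.succAbove l), fun l => x.2.1 _, ?_⟩, ?_⟩
  · have := x.2.2
    rw [Fin.sum_univ_succAbove _ j] at this
    change x j + _ = 1 at this
    rwa [hx, zero_add] at this
  · ext l
    obtain rfl | ⟨l, rfl⟩ := Fin.eq_self_or_eq_succAbove j l
    · rw [map_succAbove_self, hx]
    · rw [map_succAbove_succAbove]
      rfl

/-- The union of the faces of the standard simplex other than the face opposite to `i`. -/
def horn (i : Fin (n + 2)) : Set (stdSimplex ℝ (Fin (n + 2))) := {x | ∃ j ≠ i, x j = 0}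

/-- The smallest barycentric coordinate apart from the `i`-th one. -/
noncomputable def minCoord (i : Fin (n + 2)) (x : stdSimplex ℝ (Fin (n + 2))) : ℝ :=
  Finset.univ.inf' Finset.univ_nonempty fun l : Fin (n + 1) => x (i.succAbove l)

lemma continuous_minCoord (i : Fin (n + 2)) : Continuous (minCoord i) :=
  Continuous.finset_inf'_apply _ fun l _ =>
    (continuous_apply (i.succAbove l)).comp continuous_subtype_val

lemma minCoord_le (i : Fin (n + 2)) (x : stdSimplex ℝ (Fin (n + 2))) (l : Fin (n + 1)) :
    minCoord i x ≤ x (i.succAbove l) :=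
  Finset.inf'_le _ (Finset.mem_univ l)

lemma minCoord_nonneg (i : Fin (n + 2)) (x : stdSimplex ℝ (Fin (n + 2))) : 0 ≤ minCoord i x :=
  Finset.le_inf' _ _ fun _ _ => x.2.1 _

lemma minCoord_eq_zero {i : Fin (n + 2)} {x : stdSimplex ℝ (Fin (n + 2))} (hx : x ∈ horn i) :
    minCoord i x = 0 := by
  obtain ⟨j, hj, h⟩ := hx
  obtain ⟨l, rfl⟩ := Fin.exists_succAbove_eq hj
  exact le_antisymm (h ▸ minCoord_le i x l) (minCoord_nonneg i x)

/-- The projection of the standard simplex to a horn away from a point beyond the missing face. -/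
noncomputable def hornProj (i : Fin (n + 2)) (x : stdSimplex ℝ (Fin (n + 2))) :
    stdSimplex ℝ (Fin (n + 2)) :=
  -- The factor `n + 1` counts the coordinates other than `i`: what they lose is given to coordinate
  -- `i`, so the sum stays `1`.
  ⟨i.insertNth (x i + (n + 1) * minCoord i x) fun l => x (i.succAbove l) - minCoord i x, by
    refine ⟨(Fin.forall_iff_succAbove i).2 ⟨?_, fun l => ?_⟩, ?_⟩
    · have := x.2.1 i
      have := minCoord_nonneg i x
      simp only [Fin.insertNth_apply_same]
      change 0 ≤ x.1 i + _
      positivity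
    · simpa using minCoord_le i x l
    · have := x.2.2
      rw [Fin.sum_univ_succAbove _ i] at this ⊢
      change x i + ∑ l, x (i.succAbove l) = 1 at this
      simp only [Fin.insertNth_apply_same, Fin.insertNth_apply_succAbove,
        Finset.sum_sub_distrib, Finset.sum_const, Finset.card_univ, Fintype.card_fin,
        nsmul_eq_mul]
      push_cast
      linarith⟩

@[simp]
lemma hornProj_self (i : Fin (n + 2)) (x : stdSimplex ℝ (Fin (n + 2))) :
    hornProj i x i = x i + (n + 1) * minCoord i x :=
  Fin.insertNth_apply_same (α := fun _ => ℝ) i _ fun l => x (i.succAbove l) - minCoord i x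

@[simp]
lemma hornProj_succAbove (i : Fin (n + 2)) (x : stdSimplex ℝ (Fin (n + 2))) (l : Fin (n + 1)) :
    hornProj i x (i.succAbove l) = x (i.succAbove l) - minCoord i x :=
  Fin.insertNth_apply_succAbove (α := fun _ => ℝ) i (x i + (n + 1) * minCoord i x)
    (fun l => x (i.succAbove l) - minCoord i x) l

/-- A coordinate that attains the minimum becomes zero. -/
lemma hornProj_mem (i : Fin (n + 2)) (x : stdSimplex ℝ (Fin (n + 2))) : hornProj i x ∈ horn i := by
  obtain ⟨l, -, hl⟩ := Finset.exists_mem_eq_inf' Finset.univ_nonempty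
    fun l : Fin (n + 1) => x (i.succAbove l)
  refine ⟨i.succAbove l, Fin.succAbove_ne i l, ?_⟩
  rw [hornProj_succAbove, sub_eq_zero]
  exact hl.symm

lemma continuous_hornProj (i : Fin (n + 2)) : Continuous (hornProj i) := by
  have h := continuous_minCoord i
  have h' (j) : Continuous fun x : stdSimplex ℝ (Fin (n + 2)) => x j :=
    (continuous_apply j).comp continuous_subtype_val
  refine Continuous.subtype_mk (continuous_pi ((Fin.forall_iff_succAbove i).2
    ⟨?_, fun l => ?_⟩)) _
  · simp only [Fin.insertNth_apply_same]
    exact (h' i).add (continuous_const.mul h)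
  · simp only [Fin.insertNth_apply_succAbove]
    exact (h' _).sub h

/-- The retraction of the standard simplex onto a horn. -/
noncomputable def hornRetraction (i : Fin (n + 2)) : C(stdSimplex ℝ (Fin (n + 2)), horn i) where
  toFun x := ⟨hornProj i x, hornProj_mem i x⟩
  continuous_toFun := (continuous_hornProj i).subtype_mk _

/-- On the horn the minimum is already zero, so no coordinate changes. -/
lemma hornRetraction_apply {i : Fin (n + 2)} (x : horn i) : hornRetraction i x = x := by
  refine Subtype.ext (stdSimplex.ext (funext ((Fin.forall_iff_succAbove i).2 ⟨?_, fun l => ?_⟩)))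
  · change hornProj i x i = _
    rw [hornProj_self, minCoord_eq_zero x.2, mul_zero, add_zero]
  · change hornProj i x (i.succAbove l) = _
    rw [hornProj_succAbove, minCoord_eq_zero x.2, sub_zero]

/-- The inclusion of a face into a horn. -/
noncomputable def faceToHorn (i : Fin (n + 2)) (j : {j // j ≠ i}) :
    C(stdSimplex ℝ (Fin (n + 1)), horn i) where
  toFun a := ⟨map j.1.succAbove a, j.1, j.2, map_succAbove_self _ _⟩
  continuous_toFun := Continuous.subtype_mk (continuous_map _) _

lemma faceToHorn_injective (i : Fin (n + 2)) (j : {j // j ≠ i}) :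
    Function.Injective (faceToHorn i j) :=
  fun _ _ h => map_succAbove_injective j.1 (congrArg Subtype.val h)

lemma isClosedEmbedding_faceToHorn (i : Fin (n + 2)) (j : {j // j ≠ i}) :
    Topology.IsClosedEmbedding (faceToHorn i j) :=
  have : CompactSpace (stdSimplex ℝ (Fin (n + 1))) :=
    isCompact_iff_compactSpace.1 (isCompact_stdSimplex ℝ _)
  (faceToHorn i j).continuous.isClosedEmbedding (faceToHorn_injective i j)

/-- A point of two different faces of a simplex comes from the face of codimension two. -/
lemma exists_map_succAbove_of_map_succAbove_eq {j k : Fin (n + 3)} (hjk : j < k)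
    {a b : stdSimplex ℝ (Fin (n + 2))} (h : map j.succAbove a = map k.succAbove b) :
    ∃ c, map (k.pred (Fin.ne_zero_of_lt hjk)).succAbove c = a ∧
      map (j.castPred (Fin.ne_last_of_lt hjk)).succAbove c = b := by
  have hk : j.succAbove (k.pred (Fin.ne_zero_of_lt hjk)) = k := Fin.succAbove_pred_of_lt _ _ hjk
  -- Coordinate `k` of the common point vanishes since it lies in face `k`; inside face `j < k` that
  -- coordinate has index `k - 1`.
  obtain ⟨c, rfl⟩ : ∃ c, map (k.pred (Fin.ne_zero_of_lt hjk)).succAbove c = a := by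
    refine exists_map_succAbove_eq ?_
    rw [← map_succAbove_succAbove j, hk, h, map_succAbove_self]
  refine ⟨c, rfl, map_succAbove_injective k ?_⟩
  rw [← h, map_comp_apply, map_comp_apply]
  congr 1
  funext l
  obtain ⟨j, rfl⟩ := j.eq_castSucc_of_ne_last (Fin.ne_last_of_lt hjk)
  obtain ⟨k, rfl⟩ := k.eq_succ_of_ne_zero (Fin.ne_zero_of_lt hjk)
  -- After cancelling face `k`, what remains is the cosimplicial identity for two face maps.
  have := SimplexCategory.δ_comp_δ (n := n) (i := j) (j := k) (Fin.le_def.2 (Nat.lt_succ_iff.1 hjk))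
  exact DFunLike.congr_fun (congrArg SimplexCategory.Hom.toOrderHom this) l

end stdSimplex

/-! ### The Kan property of `sing X` and the main theorem. -/

namespace MultiMap

variable {X : Type u} [TopologicalSpace X]

lemma sing_δ_eq_iff {n : ℕ} (j : Fin (n + 2)) (S : (sing X) _⦋n + 1⦌) (T : (sing X) _⦋n⦌) :
    (sing X).δ j S = T ↔
      ∀ (a : stdSimplex ℝ (Fin (n + 1))) (y : X),
        (stdSimplex.map j.succAbove a, y) ∈ S.graph ↔ (a, y) ∈ T.graph :=
  ⟨fun h _ _ => h ▸ Iff.rfl, fun h => graph_injective (Set.ext fun p => h p.1 p.2)⟩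

instance kanComplex_sing (X : Type u) [TopologicalSpace X] : SSet.KanComplex (sing X) := by
  rw [SSet.KanComplex.iff]
  intro n i f hf
  let T (j : {j // j ≠ i}) : MultiMap (stdSimplex ℝ (Fin (n + 1))) X :=
    SSet.yonedaEquiv (f j.1 j.2)
  have key (j k : {j // j ≠ i}) (hjk : j.1 < k.1) (a b : stdSimplex ℝ (Fin (n + 1))) (y : X)
      (h : stdSimplex.map j.1.succAbove a = stdSimplex.map k.1.succAbove b) :
      (a, y) ∈ (T j).graph ↔ (b, y) ∈ (T k).graph := by
    -- A horn of the `1`-simplex has a single face, so `j < k` cannot both differ from `i`. In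
    -- higher dimensions the common point lies in a codimension-two face, where the horn data agree.
    obtain _ | n := n
    · have := j.2
      have := k.2
      omega
    · obtain ⟨c, rfl, rfl⟩ := stdSimplex.exists_map_succAbove_of_map_succAbove_eq hjk h
      have h := congrArg SSet.yonedaEquiv (hf j.1 k.1 j.2 k.2 hjk)
      rw [SSet.stdSimplex.yonedaEquiv_δ_comp, SSet.stdSimplex.yonedaEquiv_δ_comp,
        sing_δ_eq_iff] at h
      exact h c y
  obtain ⟨S, hS, -⟩ := existsUnique_precomp_eq (stdSimplex.faceToHorn i)
    (stdSimplex.isClosedEmbedding_faceToHorn i)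
    (by
      rintro ⟨x, j, hj, hx⟩
      obtain ⟨a, rfl⟩ := stdSimplex.exists_map_succAbove_eq hx
      exact ⟨⟨j, hj⟩, a, rfl⟩) T
    (by
      intro j k a b y h hy
      rcases lt_trichotomy j.1 k.1 with hjk | hjk | hjk
      · exact (key j k hjk a b y (congrArg Subtype.val h)).1 hy
      · obtain rfl := Subtype.ext hjk
        rwa [← stdSimplex.faceToHorn_injective i j h]
      · exact (key k j hjk b a y (congrArg Subtype.val h).symm).2 hy)
  -- The filler. Its faces are the prescribed ones because the retraction fixes every point of the
  -- horn.
  let σ : (sing X) _⦋n + 1⦌ := S.precomp (stdSimplex.hornRetraction i)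
  refine ⟨SSet.yonedaEquiv.symm σ, fun j hj => ?_⟩
  rw [SSet.stdSimplex.δ_comp_yonedaEquiv_symm, Equiv.symm_apply_eq, sing_δ_eq_iff]
  intro a y
  change _ ↔ _ ∈ (T ⟨j, hj⟩).graph
  rw [← hS]
  change (stdSimplex.hornRetraction i (stdSimplex.faceToHorn i ⟨j, hj⟩ a).1, y) ∈ S.graph ↔ _
  rw [stdSimplex.hornRetraction_apply]
  rfl

end MultiMap

/-- The homotopy groups turn out to be trivial for every `X`, see `MultiMap.subsingleton_piM`; this
gives both the independence of the base point and the vanishing for compact Hausdorff spaces. -/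
theorem mainTheorem2 :
    (∀ (X : Type u) (Y : Type v) [TopologicalSpace X] [TopologicalSpace Y] (k : ℕ)
      (C : Fin k → Set X) (_ : ∀ i, IsClosed (C i)) (_ : ⋃ i, C i = Set.univ)
      (T : ∀ i, MultiMap (C i) Y)
      (_ : ∀ i j,
        (T i).precomp (ContinuousMap.inclusion (Set.inter_subset_left : C i ∩ C j ⊆ C i)) =
        (T j).precomp (ContinuousMap.inclusion (Set.inter_subset_right : C i ∩ C j ⊆ C j))),
      ∃! S : MultiMap X Y, ∀ i, S.restrict (C i) = T i) ∧
    (∀ (X : Type w) [TopologicalSpace X],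
      ∃ _ : SSet.KanComplex (MultiMap.sing X),
        (PathConnectedSpace X → ∀ (n : ℕ) (A B : Set X) (hA : A.Finite) (hA' : A.Nonempty)
          (hB : B.Finite) (hB' : B.Nonempty),
          Nonempty (MultiMap.PiM (n + 1) A hA hA' ≃* MultiMap.PiM (n + 1) B hB hB')) ∧
        (CompactSpace X → T2Space X → ∀ (n : ℕ) (A : Set X) (hA : A.Finite) (hA' : A.Nonempty),
          Subsingleton (MultiMap.PiM (n + 1) A hA hA'))) := by
  refine ⟨fun X Y _ _ k C hC hcov T hT => MultiMap.existsUnique_restrict_eq C hC hcov T hT,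
    fun X _ => ⟨inferInstance, fun _ n A B hA hA' hB hB' => ?_,
      fun _ _ n A hA hA' => MultiMap.subsingleton_piM n A hA hA'⟩⟩
  have := MultiMap.subsingleton_piM n A hA hA'
  have := MultiMap.subsingleton_piM n B hB hB'
  exact ⟨{ toFun _ := 1, invFun _ := 1, left_inv _ := Subsingleton.elim _ _,
           right_inv _ := Subsingleton.elim _ _, map_mul' _ _ := Subsingleton.elim _ _ }⟩
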